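/- Let $(X_t)_{t\in\mathbb Z}$ be a strictly stationary sequence of real random variables with generic element $X$, $\mathbb E[X]=0$, and right tail $\overline F(x)=\mathbb P(X>x)$. Suppose that for some integer $m\ge 1$ the sequence is $m$-dependent, i.e. for every $s\in\mathbb Z$ the families $(X_t)_{t\le s}$ and $(X_t)_{t>s+m}$ are independent. Suppose that for some $\alpha>2$, $\overline F(x)=L(x)\,x^{-\alpha}$ for $x>0$ with a slowly varying function $L$, and that the tail-balance condition $$\lim_{x\to\infty}\frac{\mathbb P(X>x)}{\mathbb P(|X|>x)}=p_+,\qquad \lim_{x\to\infty}\frac{\mathbb P(-X>x)}{\mathbb P(|X|>x)}=p_-$$ holds for some $p_+>0$, $p_-\ge 0$. Suppose further that $$\lim_{x\to\infty}\mathbb P\big(|X_h|>x\,\big|\,|X_0|>x\big)=0,\qquad h=1,\dots,m.$$ Let $S_n=X_1+\cdots+X_n$, and let $(t_n)$ be any real sequence with $t_n/\sqrt{n\log n}\to\infty$ as $n\to\infty$. Then, for every $\delta>0$, $$\lim_{n\to\infty}\ \sup_{x>\delta t_n}\left|\frac{\mathbb P(S_n>x)}{n\,\overline F(x)}-1\right|=0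 .$$ -/

import Mathlib

open MeasureTheory ProbabilityTheory Filter Topology

noncomputable section

/-- The process `(X_t)` indexed by the integers is strictly stationary: for every shift `h`, the
process `(X_{t+h})` has the same law (on the product σ-algebra of `ℤ → ℝ`) as `(X_t)`. -/
def IsStrictlyStationary {Ω : Type*} [MeasurableSpace Ω] (X : ℤ → Ω → ℝ) (μ : Measure Ω) : Prop :=
  ∀ h : ℤ, IdentDistrib (fun ω (t : ℤ) => X (t + h) ω) (fun ω (t : ℤ) => X t ω) μ μ

/-- The process `(X_t)` is `m`-dependent: for every `s`, the σ-algebras `σ(X_t : t ≤ s)` and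
`σ(X_t : t > s + m)` are independent. -/
def IsMDependent {Ω : Type*} [MeasurableSpace Ω] (m : ℕ) (X : ℤ → Ω → ℝ) (μ : Measure Ω) : Prop :=
  ∀ s : ℤ, Indep (⨆ t ∈ Set.Iic s, MeasurableSpace.comap (X t) inferInstance)
    (⨆ t ∈ Set.Ioi (s + (m : ℤ)), MeasurableSpace.comap (X t) inferInstance) μ

/-- The right tail `x ↦ P(Y > x)` of a real random variable. -/
def tailProb {Ω : Type*} [MeasurableSpace Ω] (Y : Ω → ℝ) (μ : Measure Ω) (x : ℝ) : ℝ :=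
  μ.real {ω | x < Y ω}

/-- Slow variation at infinity: measurable, eventually positive, and `L (c x) / L x → 1` as
`x → ∞` for every `c > 0`. -/
def IsSlowlyVarying (L : ℝ → ℝ) : Prop :=
  Measurable L ∧ (∀ᶠ x in atTop, 0 < L x) ∧
    ∀ c : ℝ, 0 < c → Tendsto (fun x => L (c * x) / L x) atTop (𝓝 1)

/-- The random variable `Y` is regularly varying with index `α`: `P(Y > x) = L(x) x^{-α}` for
a slowly varying function `L`. -/
def IsRegularlyVarying {Ω : Type*} [MeasurableSpace Ω] (α : ℝ) (Y : Ω → ℝ) (μ : Measure Ω) :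
    Prop :=
  ∃ L : ℝ → ℝ, IsSlowlyVarying L ∧ ∀ x : ℝ, 0 < x → tailProb Y μ x = L x * x ^ (-α)

/-- The tail-balance condition: `P(Y > x) / P(|Y| > x) → p₊` and `P(-Y > x) / P(|Y| > x) → p₋` as
`x → ∞`, for some `p₊ > 0` and `p₋ ≥ 0`. -/
def TailBalance {Ω : Type*} [MeasurableSpace Ω] (Y : Ω → ℝ) (μ : Measure Ω) : Prop :=
  ∃ pPos pNeg : ℝ, 0 < pPos ∧ 0 ≤ pNeg ∧
    Tendsto (fun x => tailProb Y μ x / tailProb (fun ω => |Y ω|) μ x) atTop (𝓝 pPos) ∧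
    Tendsto (fun x => tailProb (fun ω => -Y ω) μ x / tailProb (fun ω => |Y ω|) μ x)
      atTop (𝓝 pNeg)

/-- The partial sum `S_n = X_1 + ⋯ + X_n` (of a centered process). -/
def partialSum {Ω : Type*} (X : ℤ → Ω → ℝ) (n : ℕ) (ω : Ω) : ℝ :=
  ∑ i ∈ Finset.Icc 1 n, X (i : ℤ) ω

end

/-! This is the principle of a single big jump. Truncate at level `η x`. Unless two of the `|X_i|`
exceed `η x`, the sum `S_n` is the truncated sum plus at most one large term. If moreover the
truncated sum is at most `ε x` in absolute value, then `S_n > x` forces some `X_i > (1 - ε) x`, and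
conversely some `X_i > (1 + ε) x` forces `S_n > x`. A union bound above and a Bonferroni bound below
give `n F((1 ∓ ε) x)` up to two errors (`measureReal_partialSum_le`,
`mul_tailProb_le_measureReal_partialSum`), where `F` is the right tail of `X_0`.

Both errors are `o(n F(x))`. Pairs of exceedances: pairs more than `m` apart are independent and
cost `(n P(|X| > η x))^2`, with `n P(|X| > η x) → 0`; closer pairs are negligible by the
conditional-tail hypothesis (`tendsto_exceedancePairBound_div`). Truncated sum: the residue classes
mod `m + 1` consist of independent variables, and a Chernoff bound with parameter of order `log x /
x` beats any prescribed power of `x` for small `η`, because `n log x / x^2 → 0`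
(`exists_tendsto_measureReal_sum_cutoff_div`). Finally `ε → 0`, since `F((1 ± ε) x) / F(x) → (1 ±
ε)^(-α)`. -/

/-! ### Elementary inequalities and Potter-type power bounds. -/

theorem exp_le_quadratic_add_rpow {u b p : ℝ} (hu : u ≤ b) (hp : 0 ≤ p) :
    Real.exp u ≤ 1 + u + u ^ 2 + Real.exp b * |u| ^ p := by
  have h0 : 0 ≤ Real.exp b * |u| ^ p := by positivity
  -- On `[-1, 1]` this is Taylor's bound; below `-1`, `u + u^2 ≥ 0`; above `1` the last term alone
  -- dominates `exp b`.
  rcases le_or_gt u 1 with h1 | h1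
  · rcases le_or_gt (-1) u with h2 | h2
    · have := (abs_le.1 (Real.abs_exp_sub_one_sub_id_le (abs_le.2 ⟨h2, h1⟩))).2
      linarith
    · have : Real.exp u ≤ 1 := Real.exp_le_one_iff.2 (by linarith)
      nlinarith
  · have h3 : 1 ≤ |u| ^ p := Real.one_le_rpow (by rw [abs_of_pos] <;> linarith) hp
    have h4 : Real.exp u ≤ Real.exp b := Real.exp_le_exp.2 hu
    have h5 : Real.exp b * 1 ≤ Real.exp b * |u| ^ p := by gcongr
    nlinarith

/-- The doubling inequality is iterated over dyadic blocks starting from `[a, 2a]`, where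
monotonicity alone gives the bound. -/
theorem Antitone.eventually_const_mul_rpow_neg_le {f : ℝ → ℝ} (hf : Antitone f)
    (hpos : ∀ x, 0 < f x) {β : ℝ} (hβ : 0 ≤ β)
    (h : ∀ᶠ x in atTop, (2 : ℝ) ^ (-β) * f x ≤ f (2 * x)) :
    ∃ c > 0, ∀ᶠ x in atTop, c * x ^ (-β) ≤ f x := by
  obtain ⟨a, ha⟩ := eventually_atTop.1 (h.and (eventually_gt_atTop 0))
  have ha0 : 0 < a := (ha a le_rfl).2
  have key : ∀ k : ℕ, ∀ x, a ≤ x → x ≤ 2 ^ (k + 1) * a →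
      f (2 * a) * a ^ β * x ^ (-β) ≤ f x := by
    intro k
    induction k with
    | zero =>
      intro x hx hx2
      have hx0 : 0 < x := ha0.trans_le hx
      have h1 : a ^ β * x ^ (-β) ≤ 1 := by
        rw [Real.rpow_neg hx0.le, ← div_eq_mul_inv]
        exact div_le_one_of_le₀ (Real.rpow_le_rpow ha0.le hx hβ) (by positivity)
      calc f (2 * a) * a ^ β * x ^ (-β) = f (2 * a) * (a ^ β * x ^ (-β)) := by ring
        _ ≤ f (2 * a) * 1 := by gcongr; exact (hpos _).le
        _ ≤ f x := by rw [mul_one]; exact hf (by simpa using hx2)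
    | succ k ih =>
      intro x hx hx2
      have hx0 : 0 < x := ha0.trans_le hx
      rcases le_or_gt x (2 ^ (k + 1) * a) with h1 | h1
      · exact ih x hx h1
      · have h2 : a ≤ x / 2 := by
          have : (1 : ℝ) ≤ 2 ^ k := one_le_pow₀ (by norm_num)
          rw [pow_succ] at h1; nlinarith
        have h3 := ih (x / 2) h2 (by rw [pow_succ] at hx2; linarith)
        have h4 := (ha (x / 2) h2).1
        rw [mul_div_cancel₀ x two_ne_zero] at h4
        refine le_trans ?_ h4
        have h5 : x ^ (-β) = 2 ^ (-β) * (x / 2) ^ (-β) := by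
          rw [← Real.mul_rpow (by norm_num) (by positivity), mul_div_cancel₀ x two_ne_zero]
        rw [h5]
        calc _ = 2 ^ (-β) * (f (2 * a) * a ^ β * (x / 2) ^ (-β)) := by ring
          _ ≤ _ := by gcongr
  refine ⟨f (2 * a) * a ^ β, mul_pos (hpos _) (by positivity), ?_⟩
  filter_upwards [eventually_ge_atTop a] with x hx
  obtain ⟨k, hk⟩ := pow_unbounded_of_one_lt (x / a) (one_lt_two (α := ℝ))
  refine key k x hx ?_
  rw [div_lt_iff₀ ha0] at hk
  refine hk.le.trans ?_
  gcongr <;> simp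

theorem Antitone.eventually_le_const_mul_rpow_neg {f : ℝ → ℝ} (hf : Antitone f)
    (hpos : ∀ x, 0 < f x) {β : ℝ} (hβ : 0 ≤ β)
    (h : ∀ᶠ x in atTop, f (2 * x) ≤ (2 : ℝ) ^ (-β) * f x) :
    ∃ C > 0, ∀ᶠ x in atTop, f x ≤ C * x ^ (-β) := by
  obtain ⟨a, ha⟩ := eventually_atTop.1 (h.and (eventually_gt_atTop 0))
  have ha0 : 0 < a := (ha a le_rfl).2
  have key : ∀ k : ℕ, ∀ x, a ≤ x → x ≤ 2 ^ (k + 1) * a →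
      f x ≤ f a * (2 * a) ^ β * x ^ (-β) := by
    intro k
    induction k with
    | zero =>
      intro x hx hx2
      have hx0 : 0 < x := ha0.trans_le hx
      have h1 : 1 ≤ (2 * a) ^ β * x ^ (-β) := by
        rw [Real.rpow_neg hx0.le, ← div_eq_mul_inv, one_le_div (by positivity)]
        exact Real.rpow_le_rpow hx0.le (by simpa using hx2) hβ
      calc f x ≤ f a * 1 := by rw [mul_one]; exact hf hx
        _ ≤ f a * ((2 * a) ^ β * x ^ (-β)) := by gcongr; exact (hpos _).le
        _ = _ := by ring
    | succ k ih =>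
      intro x hx hx2
      have hx0 : 0 < x := ha0.trans_le hx
      rcases le_or_gt x (2 ^ (k + 1) * a) with h1 | h1
      · exact ih x hx h1
      · have h2 : a ≤ x / 2 := by
          have : (1 : ℝ) ≤ 2 ^ k := one_le_pow₀ (by norm_num)
          rw [pow_succ] at h1; nlinarith
        have h3 := ih (x / 2) h2 (by rw [pow_succ] at hx2; linarith)
        have h4 := (ha (x / 2) h2).1
        rw [mul_div_cancel₀ x two_ne_zero] at h4
        refine h4.trans ?_
        have h5 : x ^ (-β) = 2 ^ (-β) * (x / 2) ^ (-β) := by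
          rw [← Real.mul_rpow (by norm_num) (by positivity), mul_div_cancel₀ x two_ne_zero]
        rw [h5]
        calc _ ≤ 2 ^ (-β) * (f a * (2 * a) ^ β * (x / 2) ^ (-β)) := by gcongr
          _ = _ := by ring
  refine ⟨f a * (2 * a) ^ β, mul_pos (hpos _) (by positivity), ?_⟩
  filter_upwards [eventually_ge_atTop a] with x hx
  obtain ⟨k, hk⟩ := pow_unbounded_of_one_lt (x / a) (one_lt_two (α := ℝ))
  refine key k x hx ?_
  rw [div_lt_iff₀ ha0] at hk
  refine hk.le.trans ?_
  gcongr <;> simp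

/-! ### Uniformity over the deviation range, expressed as a filter. -/

/-- The filter of pairs `(n, x)` with `n → ∞` and `x > δ t_n`; convergence along it is convergence
as `n → ∞`, uniformly in `x > δ t_n`. -/
def deviationFilter (t : ℕ → ℝ) (δ : ℝ) : Filter (ℕ × ℝ) :=
  comap Prod.fst atTop ⊓ 𝓟 {q | δ * t q.1 < q.2}

theorem tendsto_fst_deviationFilter (t : ℕ → ℝ) (δ : ℝ) :
    Tendsto Prod.fst (deviationFilter t δ) atTop :=
  tendsto_comap.mono_left inf_le_left

theorem eventually_deviationFilter_iff {t : ℕ → ℝ} {δ : ℝ} {P : ℕ × ℝ → Prop} :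
    (∀ᶠ q in deviationFilter t δ, P q) ↔ ∀ᶠ n in atTop, ∀ x, δ * t n < x → P (n, x) := by
  rw [deviationFilter, eventually_inf_principal, eventually_comap]
  constructor
  · intro h
    filter_upwards [h] with n hn x hx using hn (n, x) rfl hx
  · intro h
    filter_upwards [h] with n hn
    rintro ⟨k, x⟩ rfl hx
    exact hn x hx

theorem tendsto_iSup_of_tendsto_deviationFilter {t : ℕ → ℝ} {δ : ℝ} {g : ℕ → ℝ → ℝ}
    (h : Tendsto (fun q : ℕ × ℝ => g q.1 q.2) (deviationFilter t δ) (𝓝 1)) :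
    Tendsto (fun n => ⨆ x ∈ Set.Ioi (δ * t n), ENNReal.ofReal |g n x - 1|) atTop (𝓝 0) := by
  have h1 : Tendsto (fun q : ℕ × ℝ => ENNReal.ofReal |g q.1 q.2 - 1|) (deviationFilter t δ)
      (𝓝 0) := by
    have h2 : Tendsto (fun q : ℕ × ℝ => |g q.1 q.2 - 1|) (deviationFilter t δ) (𝓝 0) := by
      simpa using (h.sub_const 1).abs
    simpa using ENNReal.tendsto_ofReal h2
  rw [ENNReal.tendsto_nhds_zero] at h1 ⊢
  intro ε hε
  filter_upwards [eventually_deviationFilter_iff.1 (h1 ε hε)] with n hn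
  exact iSup₂_le fun x hx => hn x hx

section
variable {t : ℕ → ℝ} {δ : ℝ}

theorem tendsto_div_sqrt_deviationFilter
    (ht : Tendsto (fun n : ℕ => t n / Real.sqrt ((n : ℝ) * Real.log (n : ℝ))) atTop atTop)
    (hδ : 0 < δ) :
    Tendsto (fun q : ℕ × ℝ => q.2 / Real.sqrt ((q.1 : ℝ) * Real.log (q.1 : ℝ)))
      (deviationFilter t δ) atTop := by
  rw [tendsto_atTop]
  intro b
  rw [eventually_deviationFilter_iff]
  filter_upwards [(ht.const_mul_atTop hδ).eventually_ge_atTop b] with n hn x hx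
  refine hn.trans ?_
  rw [← mul_div_assoc]
  exact div_le_div_of_nonneg_right hx.le (Real.sqrt_nonneg _)

theorem tendsto_log_natCast_deviationFilter :
    Tendsto (fun q : ℕ × ℝ => Real.log (q.1 : ℝ)) (deviationFilter t δ) atTop :=
  Real.tendsto_log_atTop.comp (tendsto_natCast_atTop_atTop.comp (tendsto_fst_deviationFilter t δ))

theorem tendsto_snd_deviationFilter
    (ht : Tendsto (fun n : ℕ => t n / Real.sqrt ((n : ℝ) * Real.log (n : ℝ))) atTop atTop)
    (hδ : 0 < δ) : Tendsto Prod.snd (deviationFilter t δ) atTop := by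
  refine tendsto_atTop_mono' _ ?_ (tendsto_div_sqrt_deviationFilter ht hδ)
  filter_upwards [(tendsto_div_sqrt_deviationFilter ht hδ).eventually_ge_atTop 1,
    (tendsto_fst_deviationFilter t δ).eventually_ge_atTop 1,
    (tendsto_log_natCast_deviationFilter (t := t) (δ := δ)).eventually_ge_atTop 1]
    with q h1 h2 h3
  have hn : (1 : ℝ) ≤ q.1 := by exact_mod_cast h2
  have hs : 1 ≤ Real.sqrt ((q.1 : ℝ) * Real.log q.1) := Real.one_le_sqrt.2 (by nlinarith)
  have hx : 0 ≤ q.2 := by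
    by_contra hneg
    have := div_nonpos_of_nonpos_of_nonneg (not_le.1 hneg).le (zero_le_one.trans hs)
    linarith
  exact div_le_self hx hs

/-- Write `x = r s` with `s = √(n log n) ≤ n`. Then `log x ≤ log r + log n ≤ (1 + log r) log n`, so
the ratio is at most `(1 + log r) / r^2`, however large `x` is compared with `n`. -/
theorem tendsto_mul_log_div_sq_deviationFilter
    (ht : Tendsto (fun n : ℕ => t n / Real.sqrt ((n : ℝ) * Real.log (n : ℝ))) atTop atTop)
    (hδ : 0 < δ) :
    Tendsto (fun q : ℕ × ℝ => (q.1 : ℝ) * Real.log q.2 / q.2 ^ 2) (deviationFilter t δ)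
      (𝓝 0) := by
  have hr := tendsto_div_sqrt_deviationFilter ht hδ
  have hx := tendsto_snd_deviationFilter ht hδ
  have hlim : Tendsto (fun r : ℝ => (r ^ 2)⁻¹ + Real.log r / r ^ 2) atTop (𝓝 0) := by
    have h1 : Tendsto (fun r : ℝ => (r ^ 2)⁻¹) atTop (𝓝 0) :=
      tendsto_inv_atTop_zero.comp (tendsto_pow_atTop two_ne_zero)
    have h2 : Tendsto (fun r : ℝ => Real.log r / r ^ 2) atTop (𝓝 0) := by
      have := (isLittleO_log_rpow_atTop (r := 2) two_pos).tendsto_div_nhds_zero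
      simpa using this
    simpa using h1.add h2
  refine squeeze_zero' ?_ ?_ (hlim.comp hr)
  · filter_upwards [hx.eventually_ge_atTop 1] with q hq
    have := Real.log_nonneg hq
    positivity
  · filter_upwards [hr.eventually_ge_atTop 1, hx.eventually_ge_atTop 1,
      (tendsto_fst_deviationFilter t δ).eventually_ge_atTop 1,
      (tendsto_log_natCast_deviationFilter (t := t) (δ := δ)).eventually_ge_atTop 1]
      with q h1 h2 h3 h4
    obtain ⟨n, x⟩ := q
    simp only [Function.comp_apply] at *
    have hn : (1 : ℝ) ≤ n := by exact_mod_cast h3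
    set s := Real.sqrt ((n : ℝ) * Real.log n) with hs
    have hs1 : 1 ≤ s := Real.one_le_sqrt.2 (by nlinarith)
    have hs2 : s ^ 2 = n * Real.log n := Real.sq_sqrt (by positivity)
    have hsn : s ≤ n := by
      have h5 : Real.log n ≤ n := (Real.log_le_sub_one_of_pos (by positivity)).trans (by linarith)
      rw [hs, Real.sqrt_le_left (by positivity)]
      nlinarith
    set r := x / s with hrdef
    have hxr : x = r * s := by rw [hrdef]; field_simp
    have hlog : Real.log x ≤ Real.log r + Real.log n := by
      rw [hxr, Real.log_mul (by positivity) (by positivity)]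
      gcongr
    have hlr : 0 ≤ Real.log r := Real.log_nonneg h1
    calc (n : ℝ) * Real.log x / x ^ 2
        = Real.log x / (r ^ 2 * Real.log n) := by
          rw [hxr, mul_pow, hs2]; field_simp
      _ ≤ ((1 + Real.log r) * Real.log n) / (r ^ 2 * Real.log n) := by
          gcongr; nlinarith
      _ = (r ^ 2)⁻¹ + Real.log r / r ^ 2 := by field_simp
end

/-! ### Exponential moments and a Chernoff bound for truncated sums. -/

/-- Truncation at level `y`: values of absolute value above `y` are replaced by `0`. -/
noncomputable def cutoff (y z : ℝ) : ℝ := if |z| ≤ y then z else 0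

theorem measurable_cutoff (y : ℝ) : Measurable (cutoff y) :=
  Measurable.ite (measurableSet_le measurable_id.abs measurable_const) measurable_id
    measurable_const

/-- The linear term carries `z` itself, not its truncation, so that it integrates to zero without
recentering. For `|z| > y` the discrepancy is absorbed by `|l| * y ^ (1 - p) * |z| ^ p`. -/
theorem exp_mul_cutoff_le {p : ℝ} (hp : 2 < p) {y : ℝ} (hy : 0 < y) (l z : ℝ) :
    Real.exp (l * cutoff y z) ≤ 1 + l * z + l ^ 2 * z ^ 2 +
      (|l| * y ^ (1 - p) + Real.exp (|l| * y) * |l| ^ p) * |z| ^ p := by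
  by_cases h : |z| ≤ y
  · simp only [cutoff, if_pos h]
    have h1 : l * z ≤ |l| * y := (le_abs_self _).trans (by rw [abs_mul]; gcongr)
    have h2 := exp_le_quadratic_add_rpow h1 (p := p) (by linarith)
    rw [abs_mul, Real.mul_rpow (abs_nonneg _) (abs_nonneg _)] at h2
    have h3 : 0 ≤ |l| * y ^ (1 - p) * |z| ^ p := by positivity
    nlinarith
  · simp only [cutoff, if_neg h, mul_zero, Real.exp_zero]
    have hz : y < |z| := not_le.1 h
    have h1 : |z| ≤ y ^ (1 - p) * |z| ^ p := by
      have h4 : y ^ (p - 1) ≤ |z| ^ (p - 1) := Real.rpow_le_rpow hy.le hz.le (by linarith)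
      have h5 : |z| ^ p = |z| ^ (p - 1) * |z| := by
        rw [← Real.rpow_add_one (hy.trans hz).ne']; congr 1; ring
      have h6 : y ^ (1 - p) * y ^ (p - 1) = 1 := by
        rw [← Real.rpow_add hy]; simp
      rw [h5, ← mul_assoc]
      refine le_mul_of_one_le_left (abs_nonneg _) ?_
      calc 1 = y ^ (1 - p) * y ^ (p - 1) := h6.symm
        _ ≤ _ := by gcongr
    have h2 : -(l * z) ≤ |l| * (y ^ (1 - p) * |z| ^ p) := by
      refine (neg_le_abs _).trans ?_
      rw [abs_mul]; gcongr
    have h3 : 0 ≤ Real.exp (|l| * y) * |l| ^ p * |z| ^ p := by positivity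
    nlinarith [sq_nonneg (l * z)]

section
variable {Ω : Type*} [MeasurableSpace Ω] {μ : Measure Ω}

theorem lintegral_exp_mul_cutoff_le [IsProbabilityMeasure μ] {Z : Ω → ℝ} {p : ℝ} (hp : 2 < p)
    (h1 : Integrable Z μ) (h2 : Integrable (fun ω => Z ω ^ 2) μ)
    (hpi : Integrable (fun ω => |Z ω| ^ p) μ) (h0 : ∫ ω, Z ω ∂μ = 0)
    {y : ℝ} (hy : 0 < y) (l : ℝ) :
    ∫⁻ ω, ENNReal.ofReal (Real.exp (l * cutoff y (Z ω))) ∂μ ≤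
      ENNReal.ofReal (Real.exp (l ^ 2 * ∫ ω, Z ω ^ 2 ∂μ +
        (|l| * y ^ (1 - p) + Real.exp (|l| * y) * |l| ^ p) * ∫ ω, |Z ω| ^ p ∂μ)) := by
  set C := |l| * y ^ (1 - p) + Real.exp (|l| * y) * |l| ^ p with hC
  have hint1 : Integrable (fun ω => 1 + l * Z ω) μ := (integrable_const 1).add (h1.const_mul l)
  have hint2 : Integrable (fun ω => 1 + l * Z ω + l ^ 2 * Z ω ^ 2) μ :=
    hint1.add (h2.const_mul _)
  have hint : Integrable (fun ω => 1 + l * Z ω + l ^ 2 * Z ω ^ 2 + C * |Z ω| ^ p) μ :=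
    hint2.add (hpi.const_mul C)
  have hle : ∀ ω, Real.exp (l * cutoff y (Z ω)) ≤
      1 + l * Z ω + l ^ 2 * Z ω ^ 2 + C * |Z ω| ^ p := fun ω => exp_mul_cutoff_le hp hy l _
  calc ∫⁻ ω, ENNReal.ofReal (Real.exp (l * cutoff y (Z ω))) ∂μ
      ≤ ∫⁻ ω, ENNReal.ofReal (1 + l * Z ω + l ^ 2 * Z ω ^ 2 + C * |Z ω| ^ p) ∂μ :=
        lintegral_mono fun ω => ENNReal.ofReal_le_ofReal (hle ω)
    _ = ENNReal.ofReal (∫ ω, (1 + l * Z ω + l ^ 2 * Z ω ^ 2 + C * |Z ω| ^ p) ∂μ) :=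
        (ofReal_integral_eq_lintegral_ofReal hint
          (Eventually.of_forall fun ω => (Real.exp_pos _).le.trans (hle ω))).symm
    _ ≤ _ := by
        apply ENNReal.ofReal_le_ofReal
        rw [integral_add hint2 (hpi.const_mul C), integral_add hint1 (h2.const_mul _),
          integral_add (integrable_const 1) (h1.const_mul l), integral_const_mul,
          integral_const_mul, integral_const_mul, h0]
        simp only [integral_const, probReal_univ, smul_eq_mul, mul_one, mul_zero, add_zero]
        linarith [Real.add_one_le_exp (l ^ 2 * ∫ ω, Z ω ^ 2 ∂μ + C * ∫ ω, |Z ω| ^ p ∂μ)]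

/-- By the layer-cake formula, the question is the integrability of `s ^ (p - 1 - q)` at infinity.
-/
theorem integrable_abs_rpow_of_tailProb_le [IsProbabilityMeasure μ] {Z : Ω → ℝ} (hZ : Measurable Z) {p q C : ℝ}
    (hp : 0 < p) (hpq : p < q)
    (h : ∀ᶠ x in atTop, tailProb (fun ω => |Z ω|) μ x ≤ C * x ^ (-q)) :
    Integrable (fun ω => |Z ω| ^ p) μ := by
  obtain ⟨a, ha⟩ := eventually_atTop.1 (h.and (eventually_gt_atTop 0))
  have ha0 : 0 < a := (ha a le_rfl).2
  have hm : Measurable fun ω => |Z ω| ^ p := hZ.abs.pow_const p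
  refine ⟨hm.aestronglyMeasurable, ?_⟩
  rw [hasFiniteIntegral_iff_ofReal (Eventually.of_forall fun ω => by positivity),
    lintegral_rpow_eq_lintegral_meas_lt_mul μ (Eventually.of_forall fun ω => abs_nonneg (Z ω))
      hZ.abs.aemeasurable hp]
  refine ENNReal.mul_lt_top ENNReal.ofReal_lt_top ?_
  rw [← Set.Ioc_union_Ioi_eq_Ioi ha0.le]
  refine (lintegral_union_le _ _ _).trans_lt (ENNReal.add_lt_top.2 ⟨?_, ?_⟩)
  · have hi : IntegrableOn (fun s : ℝ => s ^ (p - 1)) (Set.Ioc 0 a) :=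
      (intervalIntegrable_iff_integrableOn_Ioc_of_le ha0.le).1
        (intervalIntegral.intervalIntegrable_rpow' (by linarith))
    refine lt_of_le_of_lt ?_ hi.lintegral_lt_top
    refine lintegral_mono fun s => ?_
    exact mul_le_of_le_one_left (by positivity) prob_le_one
  · have hi : IntegrableOn (fun s : ℝ => C * s ^ (p - 1 - q)) (Set.Ioi a) :=
      (integrableOn_Ioi_rpow_of_lt (by linarith) ha0).const_mul C
    refine lt_of_le_of_lt ?_ hi.lintegral_lt_top
    refine setLIntegral_mono' measurableSet_Ioi fun s hs => ?_
    have hs0 : 0 < s := ha0.trans hs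
    have h1 := (ha s (le_of_lt hs)).1
    have h2 : μ {ω | s < |Z ω|} ≤ ENNReal.ofReal (C * s ^ (-q)) := by
      rw [← ENNReal.ofReal_toReal (measure_ne_top μ _)]
      exact ENNReal.ofReal_le_ofReal h1
    calc _ ≤ ENNReal.ofReal (C * s ^ (-q)) * ENNReal.ofReal (s ^ (p - 1)) := by gcongr
      _ = ENNReal.ofReal (C * s ^ (p - 1 - q)) := by
        rw [← ENNReal.ofReal_mul' (by positivity), mul_assoc, ← Real.rpow_add hs0]
        congr 3; ring

variable {X : ℤ → Ω → ℝ} {m : ℕ}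

theorem measurable_comap_iSup {Ω : Type*} {X : ℤ → Ω → ℝ} {s : Set ℤ} {i : ℤ} (hi : i ∈ s) :
    Measurable[⨆ t ∈ s, MeasurableSpace.comap (X t) inferInstance] (X i) :=
  (comap_measurable (X i)).mono
    (le_iSup₂ (f := fun t (_ : t ∈ s) => MeasurableSpace.comap (X t) inferInstance) i hi) le_rfl

theorem IsMDependent.lintegral_prod_eq [IsProbabilityMeasure μ] (hdep : IsMDependent m X μ) (hX : ∀ t, Measurable (X t))
    {g : ℝ → ENNReal} (hg : Measurable g) (S : Finset ℕ)
    (hS : ∀ i ∈ S, ∀ j ∈ S, i < j → i + m < j) :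
    ∫⁻ ω, ∏ i ∈ S, g (X i ω) ∂μ = ∏ i ∈ S, ∫⁻ ω, g (X i ω) ∂μ := by
  induction S using Finset.induction_on_max with
  | empty => simp
  | insert a s hmax ih =>
    have ha : a ∉ s := fun h => lt_irrefl _ (hmax a h)
    have ih' := ih fun i hi j hj => hS i (Finset.mem_insert_of_mem hi) j
      (Finset.mem_insert_of_mem hj)
    simp_rw [Finset.prod_insert ha]
    rw [← ih', mul_comm]
    simp_rw [mul_comm (g _)]
    -- The cut isolates the largest index: the others are at most `a - m - 1`, while `a > (a - m -
    -- 1) + m`.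
    have hind := hdep ((a : ℤ) - m - 1)
    refine lintegral_mul_eq_lintegral_mul_lintegral_of_independent_measurableSpace
      (iSup₂_le fun t _ => (hX t).comap_le) (iSup₂_le fun t _ => (hX t).comap_le) hind ?_ ?_
    · refine Finset.measurable_prod _ fun i hi => hg.comp (measurable_comap_iSup ?_)
      have := hS i (Finset.mem_insert_of_mem hi) a (Finset.mem_insert_self _ _) (hmax i hi)
      simp only [Set.mem_Iic]; omega
    · refine hg.comp (measurable_comap_iSup ?_)
      simp only [Set.mem_Ioi]; omega

theorem IsMDependent.measure_inter_eq (hdep : IsMDependent m X μ) {s : Set ℝ}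
    (hs : MeasurableSet s) {i j : ℤ} (hij : i + m < j) :
    μ (X i ⁻¹' s ∩ X j ⁻¹' s) = μ (X i ⁻¹' s) * μ (X j ⁻¹' s) :=
  (Indep_iff _ _ μ).1 (hdep i) _ _ (measurable_comap_iSup (by simp) hs)
    (measurable_comap_iSup (by simpa using hij) hs)

theorem IsStrictlyStationary.identDistrib (hstat : IsStrictlyStationary X μ) (i : ℤ) :
    IdentDistrib (X i) (X 0) μ μ := by
  have := (hstat i).comp (u := fun f : ℤ → ℝ => f 0) (measurable_pi_apply 0)
  simpa [Function.comp_def] using this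

theorem IsStrictlyStationary.measure_inter_eq (hstat : IsStrictlyStationary X μ) (i h : ℤ)
    {s : Set ℝ} (hs : MeasurableSet s) :
    μ (X i ⁻¹' s ∩ X (i + h) ⁻¹' s) = μ (X 0 ⁻¹' s ∩ X h ⁻¹' s) := by
  have hm : MeasurableSet ((fun f : ℤ → ℝ => f 0) ⁻¹' s ∩ (fun f : ℤ → ℝ => f h) ⁻¹' s) :=
    (measurable_pi_apply 0 hs).inter (measurable_pi_apply h hs)
  have := (hstat i).measure_mem_eq hm
  simpa [Set.preimage, Set.inter_def, add_comm] using this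

theorem measure_le_abs_sum_cutoff_le_of_separated [IsProbabilityMeasure μ] (hX : ∀ t, Measurable (X t))
    (hstat : IsStrictlyStationary X μ) (hdep : IsMDependent m X μ)
    {p : ℝ} (hp : 2 < p) (h1 : Integrable (X 0) μ) (h2 : Integrable (fun ω => X 0 ω ^ 2) μ)
    (hpi : Integrable (fun ω => |X 0 ω| ^ p) μ) (h0 : ∫ ω, X 0 ω ∂μ = 0)
    {y : ℝ} (hy : 0 < y) {l : ℝ} (hl : 0 < l) (z : ℝ) {n : ℕ} (S : Finset ℕ) (hn : S.card ≤ n)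
    (hS : ∀ i ∈ S, ∀ j ∈ S, i < j → i + m < j) :
    μ {ω | z ≤ |∑ i ∈ S, cutoff y (X i ω)|} ≤
      2 * ENNReal.ofReal (Real.exp (-(l * z) + n * (l ^ 2 * ∫ ω, X 0 ω ^ 2 ∂μ +
        (l * y ^ (1 - p) + Real.exp (l * y) * l ^ p) * ∫ ω, |X 0 ω| ^ p ∂μ))) := by
  set c := l ^ 2 * ∫ ω, X 0 ω ^ 2 ∂μ +
        (l * y ^ (1 - p) + Real.exp (l * y) * l ^ p) * ∫ ω, |X 0 ω| ^ p ∂μ with hc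
  have hc0 : 0 ≤ c := by
    have : 0 ≤ ∫ ω, X 0 ω ^ 2 ∂μ := integral_nonneg fun ω => by positivity
    have : 0 ≤ ∫ ω, |X 0 ω| ^ p ∂μ := integral_nonneg fun ω => by positivity
    positivity
  have key : ∀ r : ℝ, |r| = l → μ {ω | l * z ≤ r * ∑ i ∈ S, cutoff y (X i ω)} ≤
      ENNReal.ofReal (Real.exp (-(l * z) + n * c)) := by
    intro r hr
    have hg : Measurable fun x : ℝ => ENNReal.ofReal (Real.exp (r * cutoff y x)) :=
      (Real.measurable_exp.comp ((measurable_cutoff y).const_mul r)).ennreal_ofReal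
    have hprod : ∀ ω, ENNReal.ofReal (Real.exp (r * ∑ i ∈ S, cutoff y (X i ω))) =
        ∏ i ∈ S, ENNReal.ofReal (Real.exp (r * cutoff y (X i ω))) := by
      intro ω
      rw [Finset.mul_sum, Real.exp_sum, ENNReal.ofReal_prod_of_nonneg]
      exact fun i _ => (Real.exp_pos _).le
    have hmgf : ∫⁻ ω, ENNReal.ofReal (Real.exp (r * ∑ i ∈ S, cutoff y (X i ω))) ∂μ ≤
        ENNReal.ofReal (Real.exp (n * c)) := by
      simp_rw [hprod]
      rw [hdep.lintegral_prod_eq hX hg S hS]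
      calc _ ≤ ∏ i ∈ S, ENNReal.ofReal (Real.exp c) := by
            refine Finset.prod_le_prod' fun i _ => ?_
            have := ((hstat.identDistrib i).comp hg).lintegral_eq
            simp only [Function.comp_apply] at this
            rw [this]
            have := lintegral_exp_mul_cutoff_le hp h1 h2 hpi h0 hy r
            rwa [hr, ← sq_abs r, hr] at this
        _ = ENNReal.ofReal (Real.exp (S.card * c)) := by
            rw [Finset.prod_const, ← ENNReal.ofReal_pow (Real.exp_pos _).le, Real.exp_nat_mul]
        _ ≤ _ := by
            gcongr
    have hmeas : Measurable fun ω => ENNReal.ofReal (Real.exp (r * ∑ i ∈ S, cutoff y (X i ω))) := by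
      refine (Real.measurable_exp.comp (Measurable.const_mul ?_ r)).ennreal_ofReal
      exact Finset.measurable_sum _ fun i _ => (measurable_cutoff y).comp (hX i)
    have hmarkov := mul_meas_ge_le_lintegral (μ := μ) hmeas (ENNReal.ofReal (Real.exp (l * z)))
    have hset : {ω | l * z ≤ r * ∑ i ∈ S, cutoff y (X i ω)} ⊆ {ω |
        ENNReal.ofReal (Real.exp (l * z)) ≤
          ENNReal.ofReal (Real.exp (r * ∑ i ∈ S, cutoff y (X i ω)))} := fun ω hω =>
      ENNReal.ofReal_le_ofReal (Real.exp_le_exp.2 hω)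
    refine (measure_mono hset).trans ?_
    calc _ = ENNReal.ofReal (Real.exp (-(l * z))) * (ENNReal.ofReal (Real.exp (l * z)) * _) := by
          rw [← mul_assoc, ← ENNReal.ofReal_mul (Real.exp_pos _).le, ← Real.exp_add,
            neg_add_cancel, Real.exp_zero, ENNReal.ofReal_one, one_mul]
      _ ≤ ENNReal.ofReal (Real.exp (-(l * z))) * ENNReal.ofReal (Real.exp (n * c)) := by
          gcongr
          exact hmarkov.trans hmgf
      _ = _ := by rw [← ENNReal.ofReal_mul (Real.exp_pos _).le, ← Real.exp_add]
  have hsub : {ω | z ≤ |∑ i ∈ S, cutoff y (X i ω)|} ⊆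
      {ω | l * z ≤ l * ∑ i ∈ S, cutoff y (X i ω)} ∪
        {ω | l * z ≤ -l * ∑ i ∈ S, cutoff y (X i ω)} := by
    intro ω hω
    rcases le_abs.1 (show z ≤ |_| from hω) with h | h
    · exact Or.inl (mul_le_mul_of_nonneg_left h hl.le)
    · refine Or.inr ?_
      have := mul_le_mul_of_nonneg_left h hl.le
      simpa using this
  calc _ ≤ _ := measure_mono hsub
    _ ≤ _ := measure_union_le _ _
    _ ≤ _ := by
      rw [two_mul]
      exact add_le_add (key l (abs_of_pos hl)) (key (-l) (by rw [abs_neg, abs_of_pos hl]))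

/-- Distinct indices in one residue class mod `m + 1` differ by more than `m`, so the
independent-type bound applies to each class; a deviation `(m + 1) z` of the total forces a
deviation `z` in some class. -/
theorem measure_le_abs_sum_cutoff_le [IsProbabilityMeasure μ] (hX : ∀ t, Measurable (X t))
    (hstat : IsStrictlyStationary X μ) (hdep : IsMDependent m X μ)
    {p : ℝ} (hp : 2 < p) (h1 : Integrable (X 0) μ) (h2 : Integrable (fun ω => X 0 ω ^ 2) μ)
    (hpi : Integrable (fun ω => |X 0 ω| ^ p) μ) (h0 : ∫ ω, X 0 ω ∂μ = 0)
    {y : ℝ} (hy : 0 < y) {l : ℝ} (hl : 0 < l) (z : ℝ) (n : ℕ) :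
    μ.real {ω | (m + 1) * z < |∑ i ∈ Finset.Icc 1 n, cutoff y (X (i : ℤ) ω)|} ≤
      (m + 1) * (2 * (Real.exp (-(l * z) + n * (l ^ 2 * ∫ ω, X 0 ω ^ 2 ∂μ +
        (l * y ^ (1 - p) + Real.exp (l * y) * l ^ p) * ∫ ω, |X 0 ω| ^ p ∂μ)))) := by
  set R := Real.exp (-(l * z) + n * (l ^ 2 * ∫ ω, X 0 ω ^ 2 ∂μ +
        (l * y ^ (1 - p) + Real.exp (l * y) * l ^ p) * ∫ ω, |X 0 ω| ^ p ∂μ)) with hR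
  let S : ℕ → Finset ℕ := fun r => (Finset.Icc 1 n).filter fun i => i % (m + 1) = r
  have hsub : {ω | (m + 1) * z < |∑ i ∈ Finset.Icc 1 n, cutoff y (X (i : ℤ) ω)|} ⊆
      ⋃ r ∈ Finset.range (m + 1), {ω | z ≤ |∑ i ∈ S r, cutoff y (X i ω)|} := by
    intro ω hω
    by_contra hcon
    simp only [Set.mem_iUnion, Set.mem_ofPred_eq, not_exists, not_le] at hcon
    have hfib := Finset.sum_fiberwise_of_maps_to (s := Finset.Icc 1 n)
      (t := Finset.range (m + 1)) (g := fun i => i % (m + 1))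
      (fun i _ => Finset.mem_range.2 (Nat.mod_lt _ (Nat.succ_pos m)))
      (fun i : ℕ => cutoff y (X (i : ℤ) ω))
    have h3 : |∑ i ∈ Finset.Icc 1 n, cutoff y (X (i : ℤ) ω)| ≤ (m + 1) * z := by
      rw [← hfib]
      refine (Finset.abs_sum_le_sum_abs _ _).trans ?_
      refine (Finset.sum_le_sum fun r hr => (hcon r hr).le).trans ?_
      simp
    exact absurd hω (not_lt.2 h3)
  have hle : μ {ω | (m + 1) * z < |∑ i ∈ Finset.Icc 1 n, cutoff y (X (i : ℤ) ω)|} ≤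
      ENNReal.ofReal ((m + 1) * (2 * R)) := by
    refine (measure_mono hsub).trans ((measure_biUnion_finset_le _ _).trans ?_)
    refine (Finset.sum_le_sum fun r hr => measure_le_abs_sum_cutoff_le_of_separated hX hstat hdep
      hp h1 h2 hpi h0 hy hl z (n := n) (S r) ?_ ?_).trans ?_
    · exact (Finset.card_filter_le _ _).trans (by simp)
    · intro i hi j hj hij
      have hi' := (Finset.mem_filter.1 hi).2
      have hj' := (Finset.mem_filter.1 hj).2
      have hmod : i ≡ j [MOD (m + 1)] := hi'.trans hj'.symm
      have := Nat.le_of_dvd (by omega) ((Nat.modEq_iff_dvd' hij.le).1 hmod)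
      omega
    · rw [Finset.sum_const, Finset.card_range, nsmul_eq_mul, ENNReal.ofReal_mul (by positivity),
        ENNReal.ofReal_mul (by positivity)]
      gcongr
      · rw [ENNReal.ofReal_add (by positivity) (by positivity)]; simp
      · simp
  exact ENNReal.toReal_le_of_le_ofReal (by positivity) hle

end

/-! ### The single big jump: two-sided bounds for fixed `n` and `x`. -/

theorem sum_eq_sum_cutoff {ι : Type*} {s : Finset ι} {a : ι → ℝ} {y : ℝ}
    (h : ∀ i ∈ s, |a i| ≤ y) : ∑ i ∈ s, a i = ∑ i ∈ s, cutoff y (a i) :=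
  Finset.sum_congr rfl fun i hi => by simp [cutoff, h i hi]

theorem sum_eq_add_sum_cutoff {ι : Type*} {s : Finset ι} {a : ι → ℝ} {y : ℝ} {i : ι} (hi : i ∈ s)
    (hai : y < |a i|) (h : ∀ j ∈ s, j ≠ i → |a j| ≤ y) :
    ∑ j ∈ s, a j = a i + ∑ j ∈ s, cutoff y (a j) := by
  classical
  rw [← Finset.add_sum_erase s a hi, ← Finset.add_sum_erase s (fun j => cutoff y (a j)) hi,
    sum_eq_sum_cutoff (y := y) fun j hj => h j (Finset.mem_of_mem_erase hj)
      (Finset.ne_of_mem_erase hj)]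
  simp [cutoff, hai]

section
variable {Ω : Type*} [MeasurableSpace Ω] {μ : Measure Ω} {X : ℤ → Ω → ℝ} {m : ℕ}

theorem tailProb_antitone [IsFiniteMeasure μ] (Y : Ω → ℝ) : Antitone (tailProb Y μ) :=
  fun _ _ h => measureReal_mono fun _ hω => lt_of_le_of_lt h hω

theorem measurableSet_lt_abs (y : ℝ) : MeasurableSet {z : ℝ | y < |z|} :=
  measurableSet_lt measurable_const measurable_id.abs

theorem IsStrictlyStationary.tailProb_eq (hstat : IsStrictlyStationary X μ) (i : ℤ) (x : ℝ) :
    μ.real {ω | x < X i ω} = tailProb (X 0) μ x := by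
  have := (hstat.identDistrib i).measure_mem_eq (measurableSet_Ioi (a := x))
  exact congrArg ENNReal.toReal this

theorem IsStrictlyStationary.tailProb_abs_eq (hstat : IsStrictlyStationary X μ) (i : ℤ) (x : ℝ) :
    μ.real {ω | x < |X i ω|} = tailProb (fun ω => |X 0 ω|) μ x := by
  have := (hstat.identDistrib i).measure_mem_eq (measurableSet_lt_abs x)
  exact congrArg ENNReal.toReal this

/-- Upper bound for the expected number of pairs of times in `1, …, n` at which an `m`-dependent
stationary process exceeds `y` in absolute value. -/
def exceedancePairBound (X : ℤ → Ω → ℝ) (μ : Measure Ω) (m n : ℕ) (y : ℝ) : ℝ :=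
  n ^ 2 * tailProb (fun ω => |X 0 ω|) μ y ^ 2 +
    n * ∑ h ∈ Finset.Icc 1 m, μ.real ({ω | y < |X 0 ω|} ∩ {ω | y < |X (h : ℤ) ω|})

theorem sum_measureReal_exceedance_inter_le (hstat : IsStrictlyStationary X μ)
    (hdep : IsMDependent m X μ) (n : ℕ) (y : ℝ) :
    ∑ i ∈ Finset.Icc 1 n, ∑ j ∈ (Finset.Icc 1 n).filter (i < ·),
      μ.real ({ω | y < |X (i : ℤ) ω|} ∩ {ω | y < |X (j : ℤ) ω|}) ≤
        exceedancePairBound X μ m n y := by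
  set H := tailProb (fun ω => |X 0 ω|) μ y with hH
  set Q : ℕ → ℝ := fun h => μ.real ({ω | y < |X 0 ω|} ∩ {ω | y < |X (h : ℤ) ω|}) with hQ
  have hQ0 : ∀ h, 0 ≤ Q h := fun h => measureReal_nonneg
  -- Lags above `m` factorize; smaller lags reduce to `Q h` by stationarity. For fixed `i`, each lag
  -- `h` selects at most one `j`.
  have key : ∀ i j : ℕ, i < j → μ.real ({ω | y < |X (i : ℤ) ω|} ∩ {ω | y < |X (j : ℤ) ω|}) ≤
      H ^ 2 + ∑ h ∈ Finset.Icc 1 m, if j = i + h then Q h else 0 := by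
    intro i j hij
    rcases lt_or_ge (i + m) j with h | h
    · have h1 := hdep.measure_inter_eq (measurableSet_lt_abs y) (i := i) (j := j)
        (by exact_mod_cast h)
      have h2 : μ.real ({ω | y < |X (i : ℤ) ω|} ∩ {ω | y < |X (j : ℤ) ω|}) = H ^ 2 := by
        have h3 := congrArg ENNReal.toReal h1
        rw [ENNReal.toReal_mul] at h3
        rw [sq, hH]
        nth_rewrite 1 [← hstat.tailProb_abs_eq i]
        rw [← hstat.tailProb_abs_eq j]
        exact h3
      rw [h2]
      refine le_add_of_nonneg_right (Finset.sum_nonneg fun k _ => ?_)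
      split_ifs
      exacts [hQ0 k, le_rfl]
    · obtain ⟨k, rfl⟩ := Nat.exists_eq_add_of_lt hij
      have h1 := hstat.measure_inter_eq i ((k + 1 : ℕ) : ℤ) (measurableSet_lt_abs y)
      have h2 : μ.real ({ω | y < |X (i : ℤ) ω|} ∩ {ω | y < |X ((i + k + 1 : ℕ) : ℤ) ω|}) =
          Q (k + 1) := by
        have h3 := congrArg ENNReal.toReal h1
        have h4 : ((i + k + 1 : ℕ) : ℤ) = i + ((k + 1 : ℕ) : ℤ) := by push_cast; ring
        rw [h4]
        exact h3
      rw [h2]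
      have h5 : Q (k + 1) ≤ ∑ h ∈ Finset.Icc 1 m, if i + k + 1 = i + h then Q h else 0 := by
        refine le_trans ?_ (Finset.single_le_sum (fun h _ => ?_)
          (Finset.mem_Icc.2 (⟨by omega, by omega⟩ : 1 ≤ k + 1 ∧ k + 1 ≤ m)))
        · rw [if_pos (by ring)]
        · split_ifs
          exacts [hQ0 h, le_rfl]
      have := sq_nonneg H
      linarith
  have hin : ∀ i ∈ Finset.Icc 1 n, ∑ j ∈ (Finset.Icc 1 n).filter (i < ·),
      μ.real ({ω | y < |X (i : ℤ) ω|} ∩ {ω | y < |X (j : ℤ) ω|}) ≤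
        n * H ^ 2 + ∑ h ∈ Finset.Icc 1 m, Q h := by
    intro i _
    have hsum0 : ∀ j, 0 ≤ ∑ h ∈ Finset.Icc 1 m, if j = i + h then Q h else 0 := fun j =>
      Finset.sum_nonneg fun k _ => by split_ifs; exacts [hQ0 k, le_rfl]
    calc _ ≤ ∑ j ∈ (Finset.Icc 1 n).filter (i < ·),
          (H ^ 2 + ∑ h ∈ Finset.Icc 1 m, if j = i + h then Q h else 0) :=
          Finset.sum_le_sum fun j hj => key i j (Finset.mem_filter.1 hj).2
      _ ≤ ∑ j ∈ Finset.Icc 1 n,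
          (H ^ 2 + ∑ h ∈ Finset.Icc 1 m, if j = i + h then Q h else 0) :=
          Finset.sum_le_sum_of_subset_of_nonneg (Finset.filter_subset _ _)
            fun j _ _ => add_nonneg (sq_nonneg _) (hsum0 j)
      _ = n * H ^ 2 + ∑ h ∈ Finset.Icc 1 m, ∑ j ∈ Finset.Icc 1 n,
            if j = i + h then Q h else 0 := by
          rw [Finset.sum_add_distrib, Finset.sum_comm]; simp
      _ ≤ _ := by
          gcongr with h
          rw [Finset.sum_ite_eq']
          split_ifs
          exacts [le_rfl, hQ0 h]
  refine (Finset.sum_le_sum hin).trans (le_of_eq ?_)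
  simp only [Finset.sum_const, Nat.card_Icc, add_tsub_cancel_right, nsmul_eq_mul,
    exceedancePairBound, ← hH]
  ring

/-- Bonferroni: removing from `E i` its overlaps with later events makes the sets disjoint. The
overlaps are measured with the larger `A i`, so that `exceedancePairBound` controls them. -/
theorem sum_measureReal_le_measureReal_iUnion_add [IsFiniteMeasure μ] {n : ℕ} {E A : ℕ → Set Ω}
    (hE : ∀ i, MeasurableSet (E i)) (hA : ∀ i, MeasurableSet (A i)) (hEA : ∀ i, E i ⊆ A i) :
    ∑ i ∈ Finset.Icc 1 n, μ.real (E i) ≤ μ.real (⋃ i ∈ Finset.Icc 1 n, E i) +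
      ∑ i ∈ Finset.Icc 1 n, ∑ j ∈ (Finset.Icc 1 n).filter (i < ·), μ.real (A i ∩ A j) := by
  let U : ℕ → Set Ω := fun i => ⋃ j ∈ (Finset.Icc 1 n).filter (i < ·), A i ∩ A j
  have hU : ∀ i, MeasurableSet (U i) := fun i =>
    Finset.measurableSet_biUnion _ fun j _ => (hA i).inter (hA j)
  have hdisj : ∀ i ∈ Finset.Icc 1 n, ∀ j ∈ Finset.Icc 1 n, i < j →
      Disjoint (E i \ U i) (E j \ U j) := by
    intro i _ j hj hij
    rw [Set.disjoint_left]
    rintro ω ⟨h1, h2⟩ ⟨h3, -⟩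
    exact h2 (Set.mem_biUnion (Finset.mem_coe.2 (Finset.mem_filter.2 ⟨hj, hij⟩))
      ⟨hEA i h1, hEA j h3⟩)
  have hpd : Set.PairwiseDisjoint (↑(Finset.Icc 1 n)) fun i => E i \ U i := by
    intro i hi j hj hij
    rcases lt_or_gt_of_ne hij with h | h
    · exact hdisj i hi j hj h
    · exact (hdisj j hj i hi h).symm
  have hsum := measureReal_biUnion_finset (μ := μ) hpd fun i _ => (hE i).diff (hU i)
  calc _ ≤ ∑ i ∈ Finset.Icc 1 n, (μ.real (E i \ U i) + μ.real (U i)) := by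
        refine Finset.sum_le_sum fun i _ => ?_
        refine (measureReal_mono (s₂ := (E i \ U i) ∪ U i) ?_).trans (measureReal_union_le _ _)
        rw [Set.sdiff_union_self]; exact Set.subset_union_left
    _ = μ.real (⋃ i ∈ Finset.Icc 1 n, E i \ U i) + ∑ i ∈ Finset.Icc 1 n, μ.real (U i) := by
        rw [Finset.sum_add_distrib, hsum]
    _ ≤ _ := by
        gcongr with i hi
        · exact measure_ne_top _ _
        · exact Set.sdiff_subset
        · exact measureReal_biUnion_finset_le _ _

theorem measureReal_partialSum_le [IsFiniteMeasure μ]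
    (hstat : IsStrictlyStationary X μ) (hdep : IsMDependent m X μ) (n : ℕ) {x ε y : ℝ}
    (hx : 0 < x) (hε : ε < 1) :
    μ.real {ω | x < partialSum X n ω} ≤ n * tailProb (X 0) μ ((1 - ε) * x) +
      exceedancePairBound X μ m n y +
        μ.real {ω | ε * x < |∑ i ∈ Finset.Icc 1 n, cutoff y (X (i : ℤ) ω)|} := by
  set C := {ω | ε * x < |∑ i ∈ Finset.Icc 1 n, cutoff y (X (i : ℤ) ω)|} with hC
  set B := ⋃ i ∈ Finset.Icc 1 n, ⋃ j ∈ (Finset.Icc 1 n).filter (i < ·),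
      ({ω | y < |X (i : ℤ) ω|} ∩ {ω | y < |X (j : ℤ) ω|}) with hB
  have hBle : μ.real B ≤ exceedancePairBound X μ m n y := by
    refine le_trans ?_ (sum_measureReal_exceedance_inter_le hstat hdep n y)
    refine (measureReal_biUnion_finset_le _ _).trans (Finset.sum_le_sum fun i _ => ?_)
    exact measureReal_biUnion_finset_le _ _
  have hsub : {ω | x < partialSum X n ω} ⊆
      ((⋃ i ∈ Finset.Icc 1 n, {ω | (1 - ε) * x < X (i : ℤ) ω}) ∪ B) ∪ C := by
    intro ω hω
    by_contra hcon
    simp only [Set.mem_union, not_or] at hcon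
    obtain ⟨⟨h1, h2⟩, h3⟩ := hcon
    have h3' := (abs_le.1 (not_lt.1 (show ¬(ε * x < |_|) from h3))).2
    have hω' : x < ∑ i ∈ Finset.Icc 1 n, X (i : ℤ) ω := hω
    by_cases hbig : ∃ i ∈ Finset.Icc 1 n, y < |X (i : ℤ) ω|
    · obtain ⟨i, hi, hyi⟩ := hbig
      have hothers : ∀ j ∈ Finset.Icc 1 n, j ≠ i → |X (j : ℤ) ω| ≤ y := by
        intro j hj hji
        by_contra hlt
        refine h2 ?_
        simp only [hB, Set.mem_iUnion]
        rcases lt_or_gt_of_ne hji with h | h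
        · exact ⟨j, hj, i, Finset.mem_filter.2 ⟨hi, h⟩, not_le.1 hlt, hyi⟩
        · exact ⟨i, hi, j, Finset.mem_filter.2 ⟨hj, h⟩, hyi, not_le.1 hlt⟩
      have hs := sum_eq_add_sum_cutoff (a := fun i : ℕ => X (i : ℤ) ω) hi hyi hothers
      have h4 : X (i : ℤ) ω ≤ (1 - ε) * x := by
        by_contra hlt
        refine h1 ?_
        simp only [Set.mem_iUnion]
        exact ⟨i, hi, not_le.1 hlt⟩
      linarith
    · push Not at hbig
      have hs := sum_eq_sum_cutoff (a := fun i : ℕ => X (i : ℤ) ω) hbig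
      nlinarith
  calc _ ≤ _ := measureReal_mono hsub
    _ ≤ _ := measureReal_union_le _ _
    _ ≤ _ := by
      gcongr
      refine (measureReal_union_le _ _).trans (add_le_add ?_ hBle)
      refine (measureReal_biUnion_finset_le _ _).trans (le_of_eq ?_)
      simp [hstat.tailProb_eq]

/-- The pair bound enters twice: once in Bonferroni, once to discard the event of two exceedances.
-/
theorem mul_tailProb_le_measureReal_partialSum [IsFiniteMeasure μ] (hX : ∀ t, Measurable (X t))
    (hstat : IsStrictlyStationary X μ) (hdep : IsMDependent m X μ) (n : ℕ) {x ε y : ℝ}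
    (hx : 0 < x) (hε : 0 < ε) (hy : y ≤ x) :
    n * tailProb (X 0) μ ((1 + ε) * x) ≤ μ.real {ω | x < partialSum X n ω} +
      2 * exceedancePairBound X μ m n y +
        μ.real {ω | ε * x < |∑ i ∈ Finset.Icc 1 n, cutoff y (X (i : ℤ) ω)|} := by
  set C := {ω | ε * x < |∑ i ∈ Finset.Icc 1 n, cutoff y (X (i : ℤ) ω)|} with hC
  set B := ⋃ i ∈ Finset.Icc 1 n, ⋃ j ∈ (Finset.Icc 1 n).filter (i < ·),
      ({ω | y < |X (i : ℤ) ω|} ∩ {ω | y < |X (j : ℤ) ω|}) with hB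
  have hpair := sum_measureReal_exceedance_inter_le hstat hdep n y
  have hBle : μ.real B ≤ exceedancePairBound X μ m n y := by
    refine le_trans ?_ hpair
    refine (measureReal_biUnion_finset_le _ _).trans (Finset.sum_le_sum fun i _ => ?_)
    exact measureReal_biUnion_finset_le _ _
  have hlarge : ∀ z : ℝ, (1 + ε) * x < z → y < |z| := fun z hz => by
    have := le_abs_self z
    nlinarith
  have hsub : (⋃ i ∈ Finset.Icc 1 n, {ω | (1 + ε) * x < X (i : ℤ) ω}) ⊆
      ({ω | x < partialSum X n ω} ∪ B) ∪ C := by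
    intro ω hω
    by_contra hcon
    simp only [Set.mem_union, not_or] at hcon
    obtain ⟨⟨h1, h2⟩, h3⟩ := hcon
    have h3' := (abs_le.1 (not_lt.1 (show ¬(ε * x < |_|) from h3))).1
    have h1' : ∑ i ∈ Finset.Icc 1 n, X (i : ℤ) ω ≤ x := not_lt.1 h1
    simp only [Set.mem_iUnion] at hω
    obtain ⟨i, hi, hlt : (1 + ε) * x < X (i : ℤ) ω⟩ := hω
    have hyi := hlarge _ hlt
    have hothers : ∀ j ∈ Finset.Icc 1 n, j ≠ i → |X (j : ℤ) ω| ≤ y := by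
      intro j hj hji
      by_contra hlt
      refine h2 ?_
      simp only [hB, Set.mem_iUnion]
      rcases lt_or_gt_of_ne hji with h | h
      · exact ⟨j, hj, i, Finset.mem_filter.2 ⟨hi, h⟩, not_le.1 hlt, hyi⟩
      · exact ⟨i, hi, j, Finset.mem_filter.2 ⟨hj, h⟩, hyi, not_le.1 hlt⟩
    have hs := sum_eq_add_sum_cutoff (a := fun i : ℕ => X (i : ℤ) ω) hi hyi hothers
    linarith
  have hbon := sum_measureReal_le_measureReal_iUnion_add (μ := μ) (n := n)
    (E := fun i : ℕ => {ω | (1 + ε) * x < X (i : ℤ) ω}) (A := fun i : ℕ => {ω | y < |X (i : ℤ) ω|})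
    (fun i => measurableSet_lt measurable_const (hX i))
    (fun i => measurableSet_lt measurable_const (hX i).abs) (fun i ω hω => hlarge _ hω)
  have hunion : μ.real (⋃ i ∈ Finset.Icc 1 n, {ω | (1 + ε) * x < X (i : ℤ) ω}) ≤
      μ.real {ω | x < partialSum X n ω} + μ.real B + μ.real C :=
    (measureReal_mono hsub).trans ((measureReal_union_le _ _).trans
      (add_le_add (measureReal_union_le _ _) le_rfl))
  have hsum : ∑ i ∈ Finset.Icc 1 n, μ.real {ω | (1 + ε) * x < X (i : ℤ) ω} =
      n * tailProb (X 0) μ ((1 + ε) * x) := by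
    simp [hstat.tailProb_eq]
  linarith

end

/-! ### Regular variation, negligible errors and the limit. -/

section
variable {Ω : Type*} [MeasurableSpace Ω] {μ : Measure Ω} {X : ℤ → Ω → ℝ} {m : ℕ} {α : ℝ}
  {Y : Ω → ℝ}

theorem IsRegularlyVarying.tailProb_pos [IsFiniteMeasure μ] (h : IsRegularlyVarying α Y μ)
    (x : ℝ) : 0 < tailProb Y μ x := by
  obtain ⟨L, ⟨-, hL, -⟩, hF⟩ := h
  obtain ⟨z, hz, hz0, hzx⟩ := (hL.and ((eventually_gt_atTop 0).and (eventually_ge_atTop x))).exists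
  refine lt_of_lt_of_le ?_ (tailProb_antitone Y hzx)
  rw [hF z hz0]
  positivity

theorem IsRegularlyVarying.tendsto_div (h : IsRegularlyVarying α Y μ) {c : ℝ} (hc : 0 < c) :
    Tendsto (fun x => tailProb Y μ (c * x) / tailProb Y μ x) atTop (𝓝 (c ^ (-α))) := by
  obtain ⟨L, ⟨-, -, hL⟩, hF⟩ := h
  have h1 := (hL c hc).mul_const (c ^ (-α))
  rw [one_mul] at h1
  refine h1.congr' ?_
  filter_upwards [eventually_gt_atTop 0] with x hx
  rw [hF x hx, hF (c * x) (by positivity), Real.mul_rpow hc.le hx.le, ← mul_assoc,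
    mul_div_mul_right _ _ (by positivity)]
  ring

theorem tailProb_le_tailProb_abs [IsFiniteMeasure μ] (Y : Ω → ℝ) (x : ℝ) :
    tailProb Y μ x ≤ tailProb (fun ω => |Y ω|) μ x :=
  measureReal_mono fun ω hω => lt_of_lt_of_le (show x < Y ω from hω) (le_abs_self _)

theorem IsRegularlyVarying.tailProb_abs_pos [IsFiniteMeasure μ] (h : IsRegularlyVarying α Y μ)
    (x : ℝ) : 0 < tailProb (fun ω => |Y ω|) μ x :=
  (h.tailProb_pos x).trans_le (tailProb_le_tailProb_abs Y x)

theorem IsRegularlyVarying.tendsto_tailProb_abs_div [IsFiniteMeasure μ]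
    (h : IsRegularlyVarying α Y μ) {p : ℝ} (hp : 0 < p)
    (hb : Tendsto (fun x => tailProb Y μ x / tailProb (fun ω => |Y ω|) μ x) atTop (𝓝 p))
    {c : ℝ} (hc : 0 < c) :
    Tendsto (fun x => tailProb (fun ω => |Y ω|) μ (c * x) / tailProb Y μ x) atTop
      (𝓝 (p⁻¹ * c ^ (-α))) := by
  have h1 := ((hb.inv₀ hp.ne').comp (tendsto_id.const_mul_atTop hc)).mul (h.tendsto_div hc)
  refine h1.congr fun x => ?_
  have := (h.tailProb_pos (c * x)).ne'
  simp only [Function.comp_apply, id, inv_div]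
  field_simp

theorem IsRegularlyVarying.eventually_const_mul_rpow_le [IsFiniteMeasure μ]
    (h : IsRegularlyVarying α Y μ) {β : ℝ} (hβ : 0 ≤ β) (hαβ : α < β) :
    ∃ c > 0, ∀ᶠ x in atTop, c * x ^ (-β) ≤ tailProb Y μ x := by
  refine (tailProb_antitone Y).eventually_const_mul_rpow_neg_le h.tailProb_pos hβ ?_
  have hlt : (2 : ℝ) ^ (-β) < 2 ^ (-α) := Real.rpow_lt_rpow_of_exponent_lt one_lt_two (by linarith)
  filter_upwards [(h.tendsto_div two_pos).eventually_const_lt hlt] with x hx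
  exact ((lt_div_iff₀ (h.tailProb_pos x)).1 hx).le

theorem IsRegularlyVarying.eventually_tailProb_abs_le [IsFiniteMeasure μ]
    (h : IsRegularlyVarying α Y μ) {p : ℝ} (hp : 0 < p)
    (hb : Tendsto (fun x => tailProb Y μ x / tailProb (fun ω => |Y ω|) μ x) atTop (𝓝 p))
    {β : ℝ} (hβ : 0 ≤ β) (hαβ : β < α) :
    ∃ C > 0, ∀ᶠ x in atTop, tailProb (fun ω => |Y ω|) μ x ≤ C * x ^ (-β) := by
  refine (tailProb_antitone _).eventually_le_const_mul_rpow_neg h.tailProb_abs_pos hβ ?_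
  have hlt : p⁻¹ * 2 ^ (-α) * p < (2 : ℝ) ^ (-β) := by
    rw [mul_comm, mul_inv_cancel_left₀ hp.ne']
    exact Real.rpow_lt_rpow_of_exponent_lt one_lt_two (by linarith)
  filter_upwards [((h.tendsto_tailProb_abs_div hp hb two_pos).mul hb).eventually_lt_const hlt]
    with x hx
  rw [div_mul_div_cancel₀ (h.tailProb_pos x).ne'] at hx
  exact ((div_lt_iff₀ (h.tailProb_abs_pos x)).1 hx).le

theorem measureReal_inter_div_eq [IsFiniteMeasure μ] {A B : Set Ω} (hA : MeasurableSet A) :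
    μ.real (A ∩ B) / μ.real A = (μ[|A]).real B := by
  simp only [Measure.real, cond_apply hA, ENNReal.toReal_mul, ENNReal.toReal_inv]
  rw [div_eq_inv_mul]

variable {t : ℕ → ℝ} {δ : ℝ}

theorem tendsto_exceedancePairBound_div [IsProbabilityMeasure μ] (hX : ∀ t, Measurable (X t))
    (hα : 2 < α) (hRV : IsRegularlyVarying α (X 0) μ) {p : ℝ} (hp : 0 < p)
    (hb : Tendsto (fun x => tailProb (X 0) μ x / tailProb (fun ω => |X 0 ω|) μ x) atTop (𝓝 p))
    (hindep : ∀ h : ℕ, 1 ≤ h → h ≤ m →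
      Tendsto (fun x : ℝ => (μ[|{ω | x < |X 0 ω|}]).real {ω | x < |X (h : ℤ) ω|}) atTop (𝓝 0))
    (ht : Tendsto (fun n : ℕ => t n / Real.sqrt ((n : ℝ) * Real.log (n : ℝ))) atTop atTop)
    (hδ : 0 < δ) {η : ℝ} (hη : 0 < η) :
    Tendsto (fun q : ℕ × ℝ => exceedancePairBound X μ m q.1 (η * q.2) /
      (q.1 * tailProb (X 0) μ q.2)) (deviationFilter t δ) (𝓝 0) := by
  set H := tailProb (fun ω => |X 0 ω|) μ with hH
  set F := tailProb (X 0) μ with hF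
  have hx := tendsto_snd_deviationFilter ht hδ
  have hηx : Tendsto (fun q : ℕ × ℝ => η * q.2) (deviationFilter t δ) atTop :=
    hx.const_mul_atTop hη
  have hratio := (hRV.tendsto_tailProb_abs_div hp hb hη).comp hx
  have hnH : Tendsto (fun q : ℕ × ℝ => q.1 * H (η * q.2)) (deviationFilter t δ) (𝓝 0) := by
    obtain ⟨C, hC, hle⟩ := hRV.eventually_tailProb_abs_le hp hb two_pos.le hα
    have hw := (tendsto_mul_log_div_sq_deviationFilter ht hδ).const_mul (C * η ^ (-2 : ℝ))
    rw [mul_zero] at hw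
    refine squeeze_zero' (Eventually.of_forall fun q => ?_) ?_ hw
    · have := hRV.tailProb_abs_pos (η * q.2)
      positivity
    · filter_upwards [hηx.eventually hle, hx.eventually_gt_atTop 0,
        (Real.tendsto_log_atTop.comp hx).eventually_ge_atTop 1] with q h1 h2 h3
      simp only [Function.comp_apply] at h3
      calc q.1 * H (η * q.2) ≤ q.1 * (C * (η * q.2) ^ (-2 : ℝ)) := by gcongr
        _ = C * η ^ (-2 : ℝ) * (q.1 * 1 / q.2 ^ 2) := by
          rw [Real.mul_rpow hη.le h2.le, Real.rpow_neg h2.le, Real.rpow_two]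
          ring
        _ ≤ _ := by gcongr
  have hQ : Tendsto (fun q : ℕ × ℝ => ∑ h ∈ Finset.Icc 1 m,
      μ.real ({ω | η * q.2 < |X 0 ω|} ∩ {ω | η * q.2 < |X (h : ℤ) ω|}) / H (η * q.2))
      (deviationFilter t δ) (𝓝 0) := by
    rw [show (0 : ℝ) = ∑ _h ∈ Finset.Icc 1 m, 0 by simp]
    refine tendsto_finsetSum _ fun h hh => ?_
    obtain ⟨h1, h2⟩ := Finset.mem_Icc.1 hh
    refine ((hindep h h1 h2).comp hηx).congr fun q => ?_
    exact (measureReal_inter_div_eq (measurableSet_lt measurable_const (hX 0).abs)).symm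
  -- With `H` the tail of `|X 0|`, the quotient factors as `(n H(η x) + ∑ Q_h / H(η x)) * (H(η x) /
  -- F(x))`, where `Q_h` is the joint exceedance probability at lag `h`.
  have hall := (hnH.add hQ).mul hratio
  rw [add_zero, zero_mul] at hall
  refine hall.congr' ?_
  filter_upwards [(tendsto_fst_deviationFilter t δ).eventually_gt_atTop 0] with q hq
  have hn : (0 : ℝ) < q.1 := by exact_mod_cast hq
  have h1 : 0 < F q.2 := hRV.tailProb_pos q.2
  have h2 : 0 < H (η * q.2) := hRV.tailProb_abs_pos (η * q.2)
  simp only [Function.comp_apply, exceedancePairBound, ← hH, ← hF, ← Finset.sum_div]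
  field_simp

theorem exists_tendsto_measureReal_sum_cutoff_div [IsProbabilityMeasure μ]
    (hX : ∀ t, Measurable (X t)) (hstat : IsStrictlyStationary X μ) (hdep : IsMDependent m X μ)
    (hα : 2 < α) (hRV : IsRegularlyVarying α (X 0) μ) {r : ℝ} (hr : 0 < r)
    (hb : Tendsto (fun x => tailProb (X 0) μ x / tailProb (fun ω => |X 0 ω|) μ x) atTop (𝓝 r))
    (h0 : ∫ ω, X 0 ω ∂μ = 0)
    (ht : Tendsto (fun n : ℕ => t n / Real.sqrt ((n : ℝ) * Real.log (n : ℝ))) atTop atTop)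
    (hδ : 0 < δ) {ε : ℝ} (hε : 0 < ε) :
    ∃ η : ℝ, 0 < η ∧ η ≤ 1 ∧ Tendsto (fun q : ℕ × ℝ =>
      μ.real {ω | ε * q.2 < |∑ i ∈ Finset.Icc 1 q.1, cutoff (η * q.2) (X (i : ℤ) ω)|} /
        (q.1 * tailProb (X 0) μ q.2)) (deviationFilter t δ) (𝓝 0) := by
  -- `p` is the moment order in the Chernoff bound; a tail exponent `s > p` makes that moment
  -- finite.
  obtain ⟨p, hp2, hpα⟩ := exists_between hα
  obtain ⟨s, hps, hsα⟩ := exists_between hpα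
  obtain ⟨C₁, -, hC₁⟩ := hRV.eventually_tailProb_abs_le hr hb (by linarith : 0 ≤ s) hsα
  have hint : ∀ k : ℝ, 0 < k → k ≤ p → Integrable (fun ω => |X 0 ω| ^ k) μ := fun k hk hkp =>
    integrable_abs_rpow_of_tailProb_le (hX 0) hk (hkp.trans_lt hps) hC₁
  have hi1 : Integrable (X 0) μ := by
    have := hint 1 one_pos (by linarith)
    simp only [Real.rpow_one] at this
    exact (integrable_norm_iff (hX 0).aestronglyMeasurable).1 this
  have hi2 : Integrable (fun ω => X 0 ω ^ 2) μ := by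
    have := hint 2 two_pos hp2.le
    simpa using this
  have hip := hint p (by linarith) le_rfl
  obtain ⟨c, hc, hlow⟩ := hRV.eventually_const_mul_rpow_le (β := α + 1) (by linarith) (by linarith)
  set V := ∫ ω, X 0 ω ^ 2 ∂μ with hV
  set A := ∫ ω, |X 0 ω| ^ p ∂μ with hA
  have hV0 : 0 ≤ V := integral_nonneg fun ω => by positivity
  have hA0 : 0 ≤ A := integral_nonneg fun ω => by positivity
  -- With `l = K log x / x`, each class contributes `l * (ε x / (m + 1)) = (α + 3) log x`. One `log
  -- x` pays for the remaining exponent, leaving `x ^ (-(α + 2))` against the lower bound `c * x ^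
  -- (-(α + 1))` for the tail.
  set K := (α + 3) * (m + 1) / ε with hK
  have hK0 : 0 < K := by have : 0 < α + 3 := by linarith
                         positivity
  -- Truncation turns `exp (l * (η * x))` into `x ^ (K * η)`, which must stay below `x ^ (p - 2)`.
  set η := min 1 ((p - 2) / (2 * K)) with hη
  have hη0 : 0 < η := lt_min one_pos (div_pos (by linarith) (by positivity))
  have hKη : K * η + 2 - p < 0 := by
    have h1 : η ≤ (p - 2) / (2 * K) := min_le_right _ _
    rw [le_div_iff₀ (by positivity)] at h1
    nlinarith
  refine ⟨η, hη0, min_le_left _ _, ?_⟩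
  have hx := tendsto_snd_deviationFilter ht hδ
  have hw := tendsto_mul_log_div_sq_deviationFilter ht hδ
  set D := K * η ^ (1 - p) * A + K ^ 2 * V + K ^ p * A with hD
  have hwD : ∀ᶠ q in deviationFilter t δ, (q.1 : ℝ) * Real.log q.2 / q.2 ^ 2 * D < 1 := by
    have := hw.mul_const D
    rw [zero_mul] at this
    exact this.eventually_lt_const one_pos
  have hlog : ∀ᶠ x : ℝ in atTop, Real.log x ^ (p - 1) * x ^ (K * η + 2 - p) ≤ 1 := by
    have h1 := (isLittleO_log_rpow_rpow_atTop (p - 1)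
      (neg_pos.2 hKη)).bound one_pos
    filter_upwards [h1, eventually_ge_atTop 1] with x hx1 hx2
    have hl := Real.log_nonneg hx2
    have hx0 : 0 < x := by linarith
    rw [Real.norm_of_nonneg (by positivity), Real.norm_of_nonneg (by positivity), one_mul,
      Real.rpow_neg hx0.le, ← one_div, le_div_iff₀ (by positivity)] at hx1
    exact hx1
  have hinv : Tendsto (fun q : ℕ × ℝ => 2 * (m + 1) / c * q.2⁻¹) (deviationFilter t δ) (𝓝 0) := by
    simpa using (tendsto_inv_atTop_zero.comp hx).const_mul (2 * (m + 1) / c)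
  refine squeeze_zero' (Eventually.of_forall fun q => ?_) ?_ hinv
  · have := hRV.tailProb_pos q.2
    positivity
  filter_upwards [hwD, hx.eventually hlog, hx.eventually hlow, hx.eventually_ge_atTop 1,
    (Real.tendsto_log_atTop.comp hx).eventually_ge_atTop 1,
    (tendsto_fst_deviationFilter t δ).eventually_ge_atTop 1] with q hq1 hq2 hq3 hq4 hq5 hq6
  obtain ⟨n, x⟩ := q
  simp only [Function.comp_apply] at *
  have hn1 : (1 : ℝ) ≤ n := by exact_mod_cast hq6
  have hx0 : 0 < x := by linarith
  have hl0 : 0 < Real.log x := by linarith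
  set l := K * Real.log x / x with hl
  have hl0' : 0 < l := by positivity
  have hmain := measure_le_abs_sum_cutoff_le hX hstat hdep hp2 hi1 hi2 hip h0
    (mul_pos hη0 hx0) hl0' (ε * x / (m + 1)) n
  rw [mul_div_cancel₀ _ (by positivity : (m + 1 : ℝ) ≠ 0)] at hmain
  have hlz : l * (ε * x / (m + 1)) = (α + 3) * Real.log x := by
    rw [hl, hK]; field_simp
  have hexp : Real.exp (l * (η * x)) = x ^ (K * η) := by
    rw [Real.rpow_def_of_pos hx0, hl]; congr 1; field_simp
  have hlp : l ^ p = K ^ p * (Real.log x ^ (p - 1) * Real.log x) * x ^ (-p) := by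
    rw [hl, Real.div_rpow (by positivity) hx0.le, Real.mul_rpow hK0.le hl0.le,
      Real.rpow_neg hx0.le, div_eq_mul_inv, ← Real.rpow_add_one hl0.ne', sub_add_cancel]
  have hexponent : n * (l ^ 2 * V + (l * (η * x) ^ (1 - p) + Real.exp (l * (η * x)) * l ^ p) * A) ≤
      Real.log x := by
    have e1 : x ^ (1 - p) / x = x ^ (2 - p) / x ^ 2 := by
      rw [← Real.rpow_sub_one hx0.ne', ← Real.rpow_sub_natCast hx0.ne']
      congr 1; push_cast; ring
    have e2 : x ^ (K * η) * x ^ (-p) = x ^ (K * η + 2 - p) / x ^ 2 := by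
      rw [← Real.rpow_add hx0, ← Real.rpow_sub_natCast hx0.ne']
      congr 1; push_cast; ring
    have e3 : n * (l ^ 2 * V + (l * (η * x) ^ (1 - p) + Real.exp (l * (η * x)) * l ^ p) * A) =
        n * Real.log x / x ^ 2 * (K * η ^ (1 - p) * A * x ^ (2 - p) + K ^ 2 * V * Real.log x +
          K ^ p * A * (Real.log x ^ (p - 1) * x ^ (K * η + 2 - p))) := by
      have e4 : l * (η * x) ^ (1 - p) = K * Real.log x * η ^ (1 - p) * (x ^ (2 - p) / x ^ 2) := by
        rw [← e1, hl, Real.mul_rpow hη0.le hx0.le]; ring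
      have e5 : Real.exp (l * (η * x)) * l ^ p = K ^ p * (Real.log x ^ (p - 1) * Real.log x) *
          (x ^ (K * η + 2 - p) / x ^ 2) := by
        rw [← e2, hexp, hlp]; ring
      rw [e4, e5, hl]
      ring
    have e6 : x ^ (2 - p) ≤ Real.log x :=
      (Real.rpow_le_one_of_one_le_of_nonpos hq4 (by linarith)).trans hq5
    calc _ ≤ n * Real.log x / x ^ 2 * (K * η ^ (1 - p) * A * Real.log x + K ^ 2 * V * Real.log x +
          K ^ p * A * Real.log x) := by
          rw [e3]; gcongr; exact hq2.trans hq5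
      _ = (n * Real.log x / x ^ 2 * D) * Real.log x := by rw [hD]; ring
      _ ≤ 1 * Real.log x := by gcongr
      _ = _ := one_mul _
  have hbound : μ.real {ω | ε * x < |∑ i ∈ Finset.Icc 1 n, cutoff (η * x) (X (i : ℤ) ω)|} ≤
      (m + 1) * (2 * x ^ (-(α + 2))) := by
    refine hmain.trans ?_
    gcongr
    rw [Real.rpow_def_of_pos hx0]
    apply Real.exp_le_exp.2
    rw [hlz]
    linarith
  rw [div_le_iff₀ (mul_pos (by linarith) (hRV.tailProb_pos x))]
  calc _ ≤ (m + 1) * (2 * x ^ (-(α + 2))) := hbound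
    _ = 2 * (m + 1) / c * x⁻¹ * (1 * (c * x ^ (-(α + 1)))) := by
      have : x ^ (-(α + 2)) = x⁻¹ * x ^ (-(α + 1)) := by
        rw [mul_comm, ← div_eq_mul_inv, ← Real.rpow_sub_one hx0.ne']; congr 1; ring
      rw [this]; field_simp
    _ ≤ _ := by gcongr

theorem tendsto_measureReal_partialSum_div [IsProbabilityMeasure μ]
    (hX : ∀ t, Measurable (X t)) (hstat : IsStrictlyStationary X μ) (hdep : IsMDependent m X μ)
    (hα : 2 < α) (hRV : IsRegularlyVarying α (X 0) μ) (hbal : TailBalance (X 0) μ)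
    (h0 : ∫ ω, X 0 ω ∂μ = 0)
    (hindep : ∀ h : ℕ, 1 ≤ h → h ≤ m →
      Tendsto (fun x : ℝ => (μ[|{ω | x < |X 0 ω|}]).real {ω | x < |X (h : ℤ) ω|}) atTop (𝓝 0))
    (ht : Tendsto (fun n : ℕ => t n / Real.sqrt ((n : ℝ) * Real.log (n : ℝ))) atTop atTop)
    (hδ : 0 < δ) :
    Tendsto (fun q : ℕ × ℝ => μ.real {ω | q.2 < partialSum X q.1 ω} /
      (q.1 * tailProb (X 0) μ q.2)) (deviationFilter t δ) (𝓝 1) := by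
  obtain ⟨r, -, hr, -, hb, -⟩ := hbal
  have hx := tendsto_snd_deviationFilter ht hδ
  have hn := (tendsto_fst_deviationFilter t δ).eventually_gt_atTop 0
  -- For `a < 1`, `ε` is chosen with `(1 + ε) ^ (-α) > a`; for `a > 1`, with `(1 - ε) ^ (-α) < a`.
  -- The truncation level `η` then depends on `ε`.
  rw [tendsto_order]
  constructor
  · intro a ha
    have hcont : Tendsto (fun ε : ℝ => (1 + ε) ^ (-α)) (𝓝[>] 0) (𝓝 1) := by
      have : ContinuousAt (fun ε : ℝ => (1 + ε) ^ (-α)) 0 :=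
        (continuousAt_const.add continuousAt_id).rpow_const (Or.inl (by simp))
      simpa using this.tendsto.mono_left nhdsWithin_le_nhds
    obtain ⟨ε, hεa, hε⟩ := ((hcont.eventually_const_lt ha).and self_mem_nhdsWithin).exists
    have hε0 : 0 < ε := hε
    obtain ⟨η, hη0, hη1, hcut⟩ := exists_tendsto_measureReal_sum_cutoff_div hX hstat hdep hα hRV
      hr hb h0 ht hδ hε0
    have hpair := tendsto_exceedancePairBound_div hX hα hRV hr hb hindep ht hδ hη0
    have hlim := (((hRV.tendsto_div (c := 1 + ε) (by linarith)).comp hx).sub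
      (hpair.const_mul 2)).sub hcut
    rw [mul_zero, sub_zero, sub_zero] at hlim
    filter_upwards [hlim.eventually_const_lt hεa, hn, hx.eventually_gt_atTop 0] with q h1 h2 h3
    refine lt_of_lt_of_le h1 ?_
    have hn0 : (0 : ℝ) < q.1 := by exact_mod_cast h2
    have hF := hRV.tailProb_pos q.2
    have h4 := mul_tailProb_le_measureReal_partialSum hX hstat hdep q.1 h3 hε0
      (y := η * q.2) (by nlinarith)
    have h5 : tailProb (X 0) μ ((1 + ε) * q.2) / tailProb (X 0) μ q.2 =
        q.1 * tailProb (X 0) μ ((1 + ε) * q.2) / (q.1 * tailProb (X 0) μ q.2) :=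
      (mul_div_mul_left _ _ hn0.ne').symm
    simp only [Function.comp_apply]
    rw [h5, ← mul_div_assoc, ← sub_div, ← sub_div]
    gcongr
    linarith
  · intro a ha
    have hcont : Tendsto (fun ε : ℝ => (1 - ε) ^ (-α)) (𝓝[>] 0) (𝓝 1) := by
      have : ContinuousAt (fun ε : ℝ => (1 - ε) ^ (-α)) 0 :=
        (continuousAt_const.sub continuousAt_id).rpow_const (Or.inl (by simp))
      simpa using this.tendsto.mono_left nhdsWithin_le_nhds
    obtain ⟨ε, hεa, hε0, hε1⟩ := ((hcont.eventually_lt_const ha).and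
      (Ioo_mem_nhdsGT one_pos)).exists
    obtain ⟨η, hη0, hη1, hcut⟩ := exists_tendsto_measureReal_sum_cutoff_div hX hstat hdep hα hRV
      hr hb h0 ht hδ hε0
    have hpair := tendsto_exceedancePairBound_div hX hα hRV hr hb hindep ht hδ hη0
    have hlim := (((hRV.tendsto_div (c := 1 - ε) (by linarith)).comp hx).add hpair).add hcut
    rw [add_zero, add_zero] at hlim
    filter_upwards [hlim.eventually_lt_const hεa, hn, hx.eventually_gt_atTop 0] with q h1 h2 h3
    refine lt_of_le_of_lt ?_ h1
    have hn0 : (0 : ℝ) < q.1 := by exact_mod_cast h2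
    have hF := hRV.tailProb_pos q.2
    have h4 := measureReal_partialSum_le hstat hdep q.1 h3 hε1 (y := η * q.2)
    have h5 : tailProb (X 0) μ ((1 - ε) * q.2) / tailProb (X 0) μ q.2 =
        q.1 * tailProb (X 0) μ ((1 - ε) * q.2) / (q.1 * tailProb (X 0) μ q.2) :=
      (mul_div_mul_left _ _ hn0.ne').symm
    simp only [Function.comp_apply]
    rw [h5, ← add_div, ← add_div]
    gcongr

end

theorem theorem3p2 {Ω : Type*} [MeasurableSpace Ω] (μ : Measure Ω) [IsProbabilityMeasure μ]
    (X : ℤ → Ω → ℝ) (hX : ∀ t, Measurable (X t))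
    (hstat : IsStrictlyStationary X μ)
    (hmean : ∫ ω, X 0 ω ∂μ = 0)
    (m : ℕ) (hm : 1 ≤ m) (hdep : IsMDependent m X μ)
    (α : ℝ) (hα : 2 < α) (hRV : IsRegularlyVarying α (X 0) μ)
    (hbal : TailBalance (X 0) μ)
    (hindep : ∀ h : ℕ, 1 ≤ h → h ≤ m →
      Tendsto (fun x : ℝ => (μ[|{ω | x < |X 0 ω|}]).real {ω | x < |X (h : ℤ) ω|}) atTop (𝓝 0))
    (t : ℕ → ℝ)
    (ht : Tendsto (fun n : ℕ => t n / Real.sqrt ((n : ℝ) * Real.log (n : ℝ))) atTop atTop)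
    (δ : ℝ) (hδ : 0 < δ) :
    Tendsto (fun n : ℕ => ⨆ x ∈ Set.Ioi (δ * t n),
      ENNReal.ofReal |μ.real {ω | x < partialSum X n ω} / ((n : ℝ) * tailProb (X 0) μ x) - 1|)
      atTop (𝓝 0) :=
  tendsto_iSup_of_tendsto_deviationFilter (tendsto_measureReal_partialSum_div hX hstat hdep hα
    hRV hbal hmean hindep ht hδ)
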